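/- **Theorem.** *Setting.* A source $v_0$ holds $k=q\alpha$ message vectors over $\mathbb F_2$, divided into $q\ge 1$ disjoint chunks of size $\alpha$, and wants to send them to a sink $v_L$ over a line network $v_0\to v_1\to\dots\to v_L$ with $L\ge 1$ links. At each time $1,2,3,\dots$ every link carries one packet; the packet on link $i$ is received with probability $p_i\in(0,1]$, and all losses are independent. For each of its transmissions a node chooses one of the $q$ chunks uniformly at random; the source sends a uniformly random $\mathbb F_2$-linear combination of the message vectors of this chunk, and an interior node sends a uniformly random $\mathbb F_2$-linear combination of the packets of this chunk that it received at earlier times; all these random choices are independent of each other and of the losses. A chunk is decodable at the sink once the sink has received $\alpha$ packets of this chunk whose vectors of coefficients with respect to the message vectors of the chunk are linearly independent. The coding delay $T$ is the first time at which all $q$ chunks are decodable. Let $p=\min_{1\le i\le L}p_i$; the capacity is $k/p$. Logarithms are to base $2$. *Claim.* Consider a sequence of such chunked codes and networks with $k\to\infty$, where $q$, $L$, the $p_i$ and $\varepsilon\in(0,1)$ may all vary along the sequence. Assume that $$q=o\!\left(\frac{k}{L\log(kL/\varepsilon)}\right)\qquad\Bigl(\text{i.e. the chunk size is }\alpha=\omega\bigl(L\log(kL/\varepsilon)\bigr)\Bigr),$$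 and let $w$ be any sequence with $w\sim\left(\dfrac{kL^2}{q\log(kL/\varepsilon)}\right)^{1/3}$. Then there is a sequence $\delta\to 0$ such that, with $$N=\frac1p\left(k+(1+\delta)\left(\frac{kL}{w}+\sqrt{k\,wq\log\frac{wqL}{\varepsilon}}+wq\log\frac{wqL}{\varepsilon}\right)\right),$$ one has $\Pr\{T>N\}\le\varepsilon$ for all sufficiently large indices of the sequence, and moreover $(N-k/p)/(k/p)\to 0$, that is, the code is capacity-achieving. -/

import Mathlib

open Filter Asymptotics MeasureTheory ProbabilityTheory
open scoped Topology

/-- A chunked code over a line network with Bernoulli losses. The network has `L ≥ 1` links in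
tandem, link `i` joining node `i` to node `i + 1` (node `0` is the source, node `L` the sink), and
a transmission over link `i` succeeds with probability `p i`. The message consists of `q ≥ 1`
disjoint chunks of `α` message vectors each. -/
structure ChunkedLine where
  /-- number of links -/
  L : ℕ
  L_pos : 0 < L
  /-- number of chunks -/
  q : ℕ
  q_pos : 0 < q
  /-- number of message vectors in a chunk -/
  α : ℕ
  /-- success parameters of the links -/
  p : Fin L → ℝ
  p_pos : ∀ i, 0 < p i
  p_le_one : ∀ i, p i ≤ 1

namespace ChunkedLine

/-- The message size: the total number of message vectors. -/
def k (S : ChunkedLine) : ℕ := S.q * S.α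

/-- The smallest success parameter of a link. -/
noncomputable def pMin (S : ChunkedLine) : ℝ := ⨅ i, S.p i

/-- The min-cut capacity, measured (as the coding delay) in units of time. -/
noncomputable def capacity (S : ChunkedLine) : ℝ := S.k / S.pMin

/-- All the randomness of the traffic and of the code. There is one transmission over each link at
each time slot `t = 0, 1, 2, …`, where slot `t` is the time instant `t + 1`. The components are
* whether the transmission over link `i` at slot `t` succeeds;
* the chunk chosen for the transmission over link `i` at slot `t`;
* the coefficient, in the packet that the source transmits at slot `t`, of the `j`-th message
  vector of the chosen chunk;
* the coefficient, in the packet transmitted over link `i` at slot `t`, of the packet that the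
  transmitting interior node received at slot `s` (used only if there is such a packet, if `s < t`
  and if that packet belongs to the chosen chunk). -/
abbrev Outcome (S : ChunkedLine) : Type :=
  (Fin S.L × ℕ → Bool) × (Fin S.L × ℕ → Fin S.q) × (ℕ × Fin S.α → ZMod 2) ×
    (Fin S.L × ℕ × ℕ → ZMod 2)

/-- The transmission over link `i` at slot `t` succeeds. -/
def success {S : ChunkedLine} (ω : S.Outcome) (i : Fin S.L) (t : ℕ) : Prop := ω.1 (i, t) = true

/-- The chunk chosen for the transmission over link `i` at slot `t`. -/
def chunk {S : ChunkedLine} (ω : S.Outcome) (i : Fin S.L) (t : ℕ) : Fin S.q := ω.2.1 (i, t)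

/-- The coefficients used by the source. -/
def sourceCoeff {S : ChunkedLine} (ω : S.Outcome) (t : ℕ) (j : Fin S.α) : ZMod 2 :=
  ω.2.2.1 (t, j)

/-- The coefficients used by the interior nodes. -/
def coeff {S : ChunkedLine} (ω : S.Outcome) (i : Fin S.L) (t s : ℕ) : ZMod 2 := ω.2.2.2 (i, t, s)

instance (S : ChunkedLine) : Nonempty (Fin S.q) := ⟨⟨0, S.q_pos⟩⟩

/-- The uniform distribution on `𝔽₂`. -/
noncomputable def uniformBit : Measure (ZMod 2) := (PMF.uniformOfFintype (ZMod 2)).toMeasure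

instance : IsProbabilityMeasure uniformBit := by
  unfold uniformBit; infer_instance

/-- The law of the randomness: all the components are independent, the success of a transmission
over link `i` has probability `p i`, and chunks and coefficients are uniformly distributed. -/
noncomputable def prob (S : ChunkedLine) : Measure S.Outcome :=
  (Measure.infinitePi fun x : Fin S.L × ℕ =>
    bernoulliMeasure true false ⟨S.p x.1, (S.p_pos x.1).le, S.p_le_one x.1⟩).prod
  ((Measure.infinitePi fun _ : Fin S.L × ℕ => (PMF.uniformOfFintype (Fin S.q)).toMeasure).prod
  ((Measure.infinitePi fun _ : ℕ × Fin S.α => uniformBit).prod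
  (Measure.infinitePi fun _ : Fin S.L × ℕ × ℕ => uniformBit)))

open Classical in
/-- The global encoding vector of the packet transmitted over link `i` at slot `t`, as the vector
of its coefficients with respect to the `α` message vectors of the chunk that it belongs to. The
source combines all the message vectors of the chosen chunk; an interior node combines all the
packets of the chosen chunk that it has received earlier. -/
noncomputable def packet {S : ChunkedLine} (ω : S.Outcome) :
    (i : ℕ) → i < S.L → ℕ → (Fin S.α → ZMod 2)
  | 0, _, t => sourceCoeff ω t
  | i + 1, h, t =>
      ∑ s ∈ (Finset.range t).filter fun s =>
          success ω ⟨i, Nat.lt_of_succ_lt h⟩ s ∧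
            chunk ω ⟨i, Nat.lt_of_succ_lt h⟩ s = chunk ω ⟨i + 1, h⟩ t,
        coeff ω ⟨i + 1, h⟩ t s • packet ω i (Nat.lt_of_succ_lt h) s

/-- The last link, which enters the sink. -/
def lastLink (S : ChunkedLine) : Fin S.L := ⟨S.L - 1, Nat.sub_lt S.L_pos one_pos⟩

/-- By time `n`, i.e. in the slots `s < n`, the sink can decode the chunk `c`: among the packets of
this chunk that it has received there are `α` packets with linearly independent global encoding
vectors. -/
def DecodesChunk {S : ChunkedLine} (ω : S.Outcome) (c : Fin S.q) (n : ℕ) : Prop :=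
  ∃ T : Finset ℕ, T.card = S.α ∧
    (∀ s ∈ T, s < n ∧ success ω S.lastLink s ∧ chunk ω S.lastLink s = c) ∧
    LinearIndepOn (ZMod 2) (packet ω S.lastLink S.lastLink.isLt) (T : Set ℕ)

/-- The coding delay: the least time by which the sink can decode all the chunks (`⊤` if there is
no such time). -/
noncomputable def codingDelay {S : ChunkedLine} (ω : S.Outcome) : ℕ∞ :=
  ⨅ n ∈ {n : ℕ | ∀ c, DecodesChunk ω c n}, (n : ℕ∞)

/-- The probability that the coding delay is larger than `N`. -/
noncomputable def probDelayGT (S : ChunkedLine) (N : ℝ) : ENNReal :=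
  S.prob {ω | ENNReal.ofReal N < (codingDelay ω : ENNReal)}

/-- The bound
`(1 / p) (k + (1 + δ) (k L / w + √(k (w q log (w q L / ε))) + w q log (w q L / ε)))`
with `p = pMin` and binary logarithms. -/
noncomputable def delayBound (S : ChunkedLine) (ε w δ : ℝ) : ℝ :=
  1 / S.pMin * (S.k + (1 + δ) *
    (S.k * S.L / w + Real.sqrt (S.k * (w * S.q * Real.logb 2 (w * S.q * S.L / ε)))
      + w * S.q * Real.logb 2 (w * S.q * S.L / ε)))

end ChunkedLine

/-! ### Resampling in product measures -/

/-! Fix a chunk and let r_i(t) be the dimension of the space known to node i. Given the past, a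
transmission over link i raises r_{i+1} with probability at least (p_i/q)(1 - 2^(-d)), where d = r_i
- r_{i+1} (`le_prob_innovative`). For 1/2 ≤ x ≤ 1 one has 2^(-d) ≤ x^d, and x^(r_{i+1}) (1 - x^d) =
x^(r_{i+1}) - x^(r_i). The exponential moments E x^(r_i(t)) therefore satisfy a linear recursion in
i and t (`integral_pow_nodeRank_succ_le`).

Their excess over the source's constant value x^α is dominated by A^i ρ^t with ρ = 1 -
(p/q)(1-x)(1-1/A), for any A ≥ 1 (`integral_pow_nodeRank_le`). Markov's inequality and a union bound
over the chunks give the tail of the delay (`probDelayGT_le`).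

Write α = b^6 L log(kL/ε), so that b → ∞ and w ~ L b². With x = exp(-b^(-3)) and A = b³, a relative
overhead 1/(2b²) suffices. The term kL/w alone supplies it, so δ = 0 works, and the whole overhead
is O(1/b²). -/

theorem MeasureTheory.Measure.measurePreserving_infinitePi_piecewise {ι : Type*} {X : ι → Type*}
    [∀ i, MeasurableSpace (X i)] (μ : ∀ i, Measure (X i)) [∀ i, IsProbabilityMeasure (μ i)]
    (P : ι → Prop) [DecidablePred P] :
    MeasurePreserving (fun z : (∀ i, X i) × (∀ i, X i) => fun i => if P i then z.1 i else z.2 i)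
      ((Measure.infinitePi μ).prod (Measure.infinitePi μ)) (Measure.infinitePi μ) := by
  have hm : Measurable
      (fun z : (∀ i, X i) × (∀ i, X i) => fun i => if P i then z.1 i else z.2 i) := by
    refine measurable_pi_lambda _ fun i => ?_
    by_cases h : P i <;> simp only [h, if_true, if_false] <;> fun_prop
  refine ⟨hm, Measure.eq_infinitePi _ fun s t ht => ?_⟩
  rw [Measure.map_apply hm (.pi s.countable_toSet fun _ _ => ht _)]
  have : (fun z : (∀ i, X i) × (∀ i, X i) => fun i => if P i then z.1 i else z.2 i) ⁻¹'
      ((s : Set ι).pi t) = (((s.filter P : Finset ι) : Set ι).pi t) ×ˢ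
        (((s.filter fun i => ¬ P i : Finset ι) : Set ι).pi t) := by
    ext z
    simp only [Set.mem_preimage, Set.mem_pi, Set.mem_prod, Finset.mem_coe, Finset.mem_filter]
    refine ⟨fun h => ⟨fun i hi => ?_, fun i hi => ?_⟩, fun h i hi => ?_⟩
    · simpa [hi.2] using h i hi.1
    · simpa [hi.2] using h i hi.1
    · by_cases hP : P i
      · simpa [hP] using h.1 i ⟨hi, hP⟩
      · simpa [hP] using h.2 i ⟨hi, hP⟩
  rw [this, Measure.prod_prod, Measure.infinitePi_pi _ fun i _ => ht i,
    Measure.infinitePi_pi _ fun i _ => ht i, Finset.prod_filter_mul_prod_filter_not]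

theorem MeasureTheory.measurePreserving_prod_prod_comm {A B : Type*} [MeasurableSpace A]
    [MeasurableSpace B] (μ : Measure A) (ν : Measure B) [SFinite μ] [SFinite ν] :
    MeasurePreserving (fun z : (A × B) × (A × B) => ((z.1.1, z.2.1), (z.1.2, z.2.2)))
      ((μ.prod ν).prod (μ.prod ν)) ((μ.prod μ).prod (ν.prod ν)) := by
  have h1 := measurePreserving_prodAssoc μ ν (μ.prod ν)
  have h2 := (measurePreserving_prodAssoc ν μ ν).symm
  have h3 := (Measure.measurePreserving_swap (μ := ν) (ν := μ)).prod (MeasurePreserving.id ν)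
  have h4 := measurePreserving_prodAssoc μ ν ν
  have h5 := (measurePreserving_prodAssoc μ μ (ν.prod ν)).symm
  exact h5.comp (((MeasurePreserving.id μ).prod (h4.comp (h3.comp h2))).comp h1)

/-- Two independent outcomes can thus be recombined one factor at a time; `Outcome` has four
factors. -/
theorem MeasureTheory.MeasurePreserving.prod_prod {A B : Type*} [MeasurableSpace A]
    [MeasurableSpace B] {μ : Measure A} {ν : Measure B} [SFinite μ] [SFinite ν]
    {f : A × A → A} {g : B × B → B} (hf : MeasurePreserving f (μ.prod μ) μ)
    (hg : MeasurePreserving g (ν.prod ν) ν) :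
    MeasurePreserving (fun z : (A × B) × (A × B) => (f (z.1.1, z.2.1), g (z.1.2, z.2.2)))
      ((μ.prod ν).prod (μ.prod ν)) (μ.prod ν) :=
  (hf.prod hg).comp (measurePreserving_prod_prod_comm μ ν)

/-! ### Random linear combinations -/

/-- Rank-nullity for `f` and for its restriction to the preimage of `W`: both have the same kernel.
-/
theorem LinearMap.finrank_comap_add_finrank {K V M : Type*} [Field K] [AddCommGroup V] [Module K V]
    [FiniteDimensional K V] [AddCommGroup M] [Module K M] [FiniteDimensional K M]
    (f : V →ₗ[K] M) (W : Submodule K M) (hW : W ≤ LinearMap.range f) :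
    Module.finrank K (W.comap f) + Module.finrank K (LinearMap.range f) =
      Module.finrank K V + Module.finrank K W := by
  have h1 := LinearMap.finrank_range_add_finrank_ker f
  have h2 := LinearMap.finrank_range_add_finrank_ker (f.domRestrict (W.comap f))
  have h3 : LinearMap.range (f.domRestrict (W.comap f)) = W := by
    rw [LinearMap.range_domRestrict, Submodule.map_comap_eq, inf_eq_right.2 hW]
  have h4 : Module.finrank K (LinearMap.ker (f.domRestrict (W.comap f))) =
      Module.finrank K (LinearMap.ker f) := by
    rw [LinearMap.ker_domRestrict]
    exact (Submodule.comapSubtypeEquivOfLe (LinearMap.ker_le_comap f)).finrank_eq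
  rw [h3] at h2
  omega

namespace ChunkedLine

theorem uniformBit_singleton (a : ZMod 2) : uniformBit {a} = 2⁻¹ := by
  simp [uniformBit, ZMod.card]

/-- A uniformly random `𝔽₂`-linear combination of vectors lies in a subspace of their span with
probability `2⁻ᵈ` for the codimension `d`. -/
theorem infinitePi_uniformBit_sum_mem_le {ι κ M : Type*} [AddCommGroup M] [Module (ZMod 2) M]
    [FiniteDimensional (ZMod 2) M] (R : Finset κ) (j : κ → ι) (hj : Function.Injective j)
    (x : κ → M) (W : Submodule (ZMod 2) M)
    (hW : W ≤ Submodule.span (ZMod 2) (x '' R)) :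
    Measure.infinitePi (fun _ : ι => uniformBit) {y | ∑ s ∈ R, y (j s) • x s ∈ W} ≤
      2⁻¹ ^ (Module.finrank (ZMod 2) (Submodule.span (ZMod 2) (x '' (R : Set κ))) -
        Module.finrank (ZMod 2) W) := by
  classical
  set Φ := Fintype.linearCombination (ZMod 2) (fun s : R => x s) with hΦ
  have hr : LinearMap.range Φ = Submodule.span (ZMod 2) (x '' (R : Set κ)) := by
    rw [hΦ, Fintype.range_linearCombination, Set.image_eq_range]
    rfl
  -- Cover the event by one cylinder for each coefficient vector that `Φ` sends into `W`. Each has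
  -- measure 2^(-|R|), as `j` is injective, and |R| minus the dimension of the preimage is the
  -- codimension.
  have hsub : {y : ι → ZMod 2 | ∑ s ∈ R, y (j s) • x s ∈ W} ⊆
      ⋃ a : W.comap Φ, ((R.map ⟨j, hj⟩ : Finset ι) : Set ι).pi
        fun i => {v | ∀ s : R, j s = i → v = (a : R → ZMod 2) s} := by
    intro y hy
    refine Set.mem_iUnion.2 ⟨⟨fun s => y (j s), ?_⟩, ?_⟩
    · rw [Submodule.mem_comap, hΦ, Fintype.linearCombination_apply]
      have := Finset.sum_coe_sort R (fun s => y (j s) • x s)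
      rw [this]
      exact hy
    · intro i hi s hs
      simp [← hs]
  refine (measure_mono hsub).trans ((measure_iUnion_le _).trans ?_)
  have hc : ∀ a : W.comap Φ, Measure.infinitePi (fun _ : ι => uniformBit)
      (((R.map ⟨j, hj⟩ : Finset ι) : Set ι).pi
        fun i => {v | ∀ s : R, j s = i → v = (a : R → ZMod 2) s}) = 2⁻¹ ^ R.card := by
    intro a
    rw [Measure.infinitePi_pi _ fun _ _ => .of_discrete, Finset.prod_map,
      ← Finset.prod_const]
    refine Finset.prod_congr rfl fun s hs => ?_
    rw [← uniformBit_singleton ((a : R → ZMod 2) ⟨s, hs⟩)]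
    congr 1
    ext v
    simp only [Set.mem_ofPred_eq, Set.mem_singleton_iff, Function.Embedding.coeFn_mk]
    refine ⟨fun h => h ⟨s, hs⟩ rfl, fun h s' hs' => ?_⟩
    have : s' = ⟨s, hs⟩ := Subtype.ext (hj hs')
    rw [this, h]
  simp_rw [hc]
  rw [tsum_fintype, Finset.sum_const, Finset.card_univ, nsmul_eq_mul,
    Module.card_eq_pow_finrank (K := ZMod 2), ZMod.card]
  have h1 := LinearMap.finrank_comap_add_finrank Φ W (hr ▸ hW)
  have h2 := Submodule.finrank_mono hW
  rw [hr, Module.finrank_fintype_fun_eq_card, Fintype.card_coe] at h1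
  set m := Module.finrank (ZMod 2) (W.comap Φ)
  have h3 : R.card = m + (Module.finrank (ZMod 2)
    (Submodule.span (ZMod 2) (x '' (R : Set κ))) - Module.finrank (ZMod 2) W) := by omega
  rw [h3, pow_add, ← mul_assoc, Nat.cast_pow, ← mul_pow, Nat.cast_ofNat,
    ENNReal.mul_inv_cancel (by simp) (by simp), one_pow, one_mul]

variable {S : ChunkedLine}

/-! ### The spaces known to the nodes -/

open Classical in
/-- The slots before `t` at which a packet of chunk `c` is received over link `i`. -/
noncomputable def received (ω : S.Outcome) (i : Fin S.L) (c : Fin S.q) (t : ℕ) : Finset ℕ :=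
  (Finset.range t).filter fun s => success ω i s ∧ chunk ω i s = c

theorem mem_received {ω : S.Outcome} {i : Fin S.L} {c : Fin S.q} {t s : ℕ} :
    s ∈ received ω i c t ↔ s < t ∧ success ω i s ∧ chunk ω i s = c := by
  classical
  simp [received]

/-- The span of the encoding vectors of chunk `c` known to node `i` at the beginning of slot `t`;
the source knows the whole space. -/
noncomputable def nodeSpan (ω : S.Outcome) (c : Fin S.q) (t : ℕ) :
    (i : ℕ) → i ≤ S.L → Submodule (ZMod 2) (Fin S.α → ZMod 2)
  | 0, _ => ⊤
  | i + 1, h => Submodule.span (ZMod 2) (packet ω i h '' (received ω ⟨i, h⟩ c t : Set ℕ))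

/-- The dimension of the space known to node `i`. -/
noncomputable def nodeRank (ω : S.Outcome) (c : Fin S.q) (t i : ℕ) (h : i ≤ S.L) : ℕ :=
  Module.finrank (ZMod 2) (nodeSpan ω c t i h)

/-- The packet of chunk `c` that is transmitted over link `i` at slot `t` if the past is given by
`ω` and the coefficients are given by `ω'`. -/
noncomputable def freshPacket (ω ω' : S.Outcome) (c : Fin S.q) (t : ℕ) :
    (i : ℕ) → i < S.L → (Fin S.α → ZMod 2)
  | 0, _ => sourceCoeff ω' t
  | i + 1, h => ∑ s ∈ received ω ⟨i, Nat.lt_of_succ_lt h⟩ c t,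
      coeff ω' ⟨i + 1, h⟩ t s • packet ω i (Nat.lt_of_succ_lt h) s

theorem packet_eq_freshPacket (ω : S.Outcome) (t i : ℕ) (h : i < S.L) :
    packet ω i h t = freshPacket ω ω (chunk ω ⟨i, h⟩ t) t i h := by
  cases i <;> rfl

theorem received_mono (ω : S.Outcome) (i : Fin S.L) (c : Fin S.q) {s t : ℕ} (h : s ≤ t) :
    received ω i c s ⊆ received ω i c t := fun r hr => by
  rw [mem_received] at hr ⊢
  exact ⟨hr.1.trans_le h, hr.2⟩

theorem nodeSpan_mono (ω : S.Outcome) (c : Fin S.q) {s t : ℕ} (hst : s ≤ t) (i : ℕ)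
    (h : i ≤ S.L) : nodeSpan ω c s i h ≤ nodeSpan ω c t i h := by
  cases i with
  | zero => exact le_rfl
  | succ i => exact Submodule.span_mono (Set.image_mono (received_mono ω _ c hst))

theorem freshPacket_mem (ω ω' : S.Outcome) (c : Fin S.q) (t i : ℕ) (h : i < S.L) :
    freshPacket ω ω' c t i h ∈ nodeSpan ω c t i h.le := by
  cases i with
  | zero => exact Submodule.mem_top
  | succ i =>
    exact Submodule.sum_mem _ fun s hs => Submodule.smul_mem _ _ <|
      Submodule.subset_span (Set.mem_image_of_mem _ hs)

/-- Whatever a node has received was a combination of what its predecessor knew at the time of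
sending. -/
theorem nodeSpan_succ_le (ω : S.Outcome) (c : Fin S.q) (t i : ℕ) (h : i < S.L) :
    nodeSpan ω c t (i + 1) h ≤ nodeSpan ω c t i h.le := by
  refine Submodule.span_le.2 ?_
  rintro _ ⟨s, hs, rfl⟩
  obtain ⟨h1, -, h3⟩ := mem_received.1 hs
  rw [packet_eq_freshPacket, h3]
  exact nodeSpan_mono ω c h1.le i h.le (freshPacket_mem ω ω c s i h)

theorem nodeRank_zero (ω : S.Outcome) (c : Fin S.q) (t : ℕ) (h : 0 ≤ S.L) :
    nodeRank ω c t 0 h = S.α := by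
  rw [nodeRank, nodeSpan, finrank_top, Module.finrank_fintype_fun_eq_card, Fintype.card_fin]

theorem nodeRank_succ_le (ω : S.Outcome) (c : Fin S.q) (t i : ℕ) (h : i < S.L) :
    nodeRank ω c t (i + 1) h ≤ nodeRank ω c t i h.le :=
  Submodule.finrank_mono (nodeSpan_succ_le ω c t i h)

theorem nodeRank_le (ω : S.Outcome) (c : Fin S.q) (t i : ℕ) (h : i ≤ S.L) :
    nodeRank ω c t i h ≤ S.α := by
  simpa [nodeRank] using Submodule.finrank_le (nodeSpan ω c t i h)

theorem nodeRank_slot_mono (ω : S.Outcome) (c : Fin S.q) (t i : ℕ) (h : i ≤ S.L) :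
    nodeRank ω c t i h ≤ nodeRank ω c (t + 1) i h :=
  Submodule.finrank_mono (nodeSpan_mono ω c t.le_succ i h)

/-- An innovative packet increases the rank. -/
theorem nodeRank_lt_of_notMem {ω : S.Outcome} {c : Fin S.q} {t i : ℕ} {h : i < S.L}
    (h1 : success ω ⟨i, h⟩ t) (h2 : chunk ω ⟨i, h⟩ t = c)
    (h3 : packet ω i h t ∉ nodeSpan ω c t (i + 1) h) :
    nodeRank ω c t (i + 1) h + 1 ≤ nodeRank ω c (t + 1) (i + 1) h := by
  refine Submodule.finrank_lt_finrank_of_lt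
    ((nodeSpan_mono ω c t.le_succ (i + 1) h).lt_of_ne fun he => h3 ?_)
  rw [he]
  exact Submodule.subset_span
    (Set.mem_image_of_mem _ (mem_received.2 ⟨t.lt_succ_self, h1, h2⟩))

theorem decodesChunk_of_nodeRank_eq {ω : S.Outcome} {c : Fin S.q} {n : ℕ}
    (h : nodeRank ω c n S.L le_rfl = S.α) : DecodesChunk ω c n := by
  have hL : nodeSpan ω c n S.L le_rfl = Submodule.span (ZMod 2)
      (packet ω S.lastLink S.lastLink.isLt '' (received ω S.lastLink c n : Set ℕ)) := by
    have h0 := S.L_pos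
    -- `S.L` is not syntactically a successor, so `nodeSpan` unfolds only after the index is
    -- generalised.
    have : ∀ (m : ℕ) (hm : m < S.L) (_ : m + 1 = S.L), nodeSpan ω c n S.L le_rfl =
        Submodule.span (ZMod 2) (packet ω m hm '' (received ω ⟨m, hm⟩ c n : Set ℕ)) := by
      intro m hm he
      have : ∀ (l : ℕ) (hl : l ≤ S.L) (_ : m + 1 = l), nodeSpan ω c n l hl =
          Submodule.span (ZMod 2) (packet ω m hm '' (received ω ⟨m, hm⟩ c n : Set ℕ)) := by
        rintro l hl rfl
        rfl
      exact this _ _ he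
    exact this (S.L - 1) _ (by omega)
  obtain ⟨b, hb, -, hspan, hli⟩ := exists_linearIndepOn_extension
    (linearIndepOn_empty (ZMod 2) (packet ω S.lastLink S.lastLink.isLt))
    (Set.empty_subset (received ω S.lastLink c n : Set ℕ))
  have hfin : b.Finite := (Finset.finite_toSet _).subset hb
  lift b to Finset ℕ using hfin
  refine ⟨b, ?_, fun s hs => mem_received.1 (hb hs), hli⟩
  have h1 : nodeSpan ω c n S.L le_rfl = Submodule.span (ZMod 2)
      (packet ω S.lastLink S.lastLink.isLt '' (b : Set ℕ)) := by
    rw [hL]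
    exact le_antisymm (Submodule.span_le.2 hspan) (Submodule.span_mono (Set.image_mono hb))
  rw [← h, nodeRank, h1, Set.image_eq_range, finrank_span_eq_card hli]
  simp

/-! ### Measurability -/

theorem measurable_success (i : Fin S.L) (t : ℕ) :
    Measurable fun ω : S.Outcome => ω.1 (i, t) := by fun_prop

theorem measurable_chunk (i : Fin S.L) (t : ℕ) :
    Measurable fun ω : S.Outcome => chunk ω i t := by unfold chunk; fun_prop

theorem measurable_packet (i : ℕ) (h : i < S.L) (t : ℕ) :
    Measurable fun ω : S.Outcome => packet ω i h t := by
  classical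
  induction i generalizing t with
  | zero => unfold packet sourceCoeff; fun_prop
  | succ i ih =>
    simp only [packet, Finset.sum_filter]
    refine Finset.measurable_sum _ fun s _ => Measurable.ite ?_ ?_ measurable_const
    · refine (measurable_success _ s (measurableSet_singleton true)).inter ?_
      exact measurableSet_eq_fun (measurable_chunk _ s) (measurable_chunk _ t)
    · refine measurable_pi_lambda _ fun j => ?_
      simp only [Pi.smul_apply, smul_eq_mul, coeff]
      have := (measurable_pi_apply j).comp (ih (Nat.lt_of_succ_lt h) s)
      simp only [Function.comp_def] at this
      fun_prop

theorem measurable_nodeRank (c : Fin S.q) (t i : ℕ) (h : i ≤ S.L) :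
    Measurable fun ω : S.Outcome => nodeRank ω c t i h := by
  classical
  cases i with
  | zero => simp only [nodeRank_zero]; exact measurable_const
  | succ i =>
    -- The rank depends only on finitely many variables with finite ranges, and every function on
    -- such a discrete space is measurable.
    let G : (Fin t → Bool × Fin S.q × (Fin S.α → ZMod 2)) → ℕ := fun f =>
      Module.finrank (ZMod 2) (Submodule.span (ZMod 2)
        {v | ∃ s, (f s).1 = true ∧ (f s).2.1 = c ∧ (f s).2.2 = v})
    have hG : (fun ω : S.Outcome => nodeRank ω c t (i + 1) h) = G ∘ fun ω s =>
        (ω.1 (⟨i, h⟩, (s : ℕ)), chunk ω ⟨i, h⟩ s, packet ω i h s) := by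
      ext ω
      suffices hs : packet ω i h '' (received ω ⟨i, h⟩ c t : Set ℕ) = {v | ∃ s : Fin t,
          ω.1 (⟨i, h⟩, (s : ℕ)) = true ∧ chunk ω ⟨i, h⟩ s = c ∧ packet ω i h s = v} by
        exact congrArg (fun V : Set (Fin S.α → ZMod 2) =>
          Module.finrank (ZMod 2) (Submodule.span (ZMod 2) V)) hs
      ext v
      constructor
      · rintro ⟨s, hs, rfl⟩
        obtain ⟨h1, h2, h3⟩ := mem_received.1 hs
        exact ⟨⟨s, h1⟩, h2, h3, rfl⟩
      · rintro ⟨s, h2, h3, rfl⟩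
        exact ⟨s, mem_received.2 ⟨s.2, h2, h3⟩, rfl⟩
    rw [hG]
    refine (Measurable.of_discrete (f := G)).comp (measurable_pi_lambda _ fun s => ?_)
    exact (measurable_success _ _).prodMk ((measurable_chunk _ _).prodMk (measurable_packet _ _ _))

/-! ### Resampling the future -/

/-- The outcome that agrees with `z.1` before slot `t` and with `z.2` from slot `t` on. -/
def splice (t : ℕ) (z : S.Outcome × S.Outcome) : S.Outcome :=
  (fun x => if x.2 < t then z.1.1 x else z.2.1 x,
    fun x => if x.2 < t then z.1.2.1 x else z.2.2.1 x,
    fun x => if x.1 < t then z.1.2.2.1 x else z.2.2.2.1 x,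
    fun x => if x.2.1 < t then z.1.2.2.2 x else z.2.2.2.2 x)

instance : IsProbabilityMeasure S.prob := by unfold prob; infer_instance

/-- Independence of past and future in the form used below, in place of conditional expectations:
redrawing all coordinates from slot `t` on leaves the law unchanged. -/
theorem measurePreserving_splice (t : ℕ) :
    MeasurePreserving (splice (S := S) t) (S.prob.prod S.prob) S.prob :=
  (Measure.measurePreserving_infinitePi_piecewise _ fun x : Fin S.L × ℕ => x.2 < t).prod_prod
    ((Measure.measurePreserving_infinitePi_piecewise _ fun x : Fin S.L × ℕ => x.2 < t).prod_prod
      ((Measure.measurePreserving_infinitePi_piecewise _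
        fun x : ℕ × Fin S.α => x.1 < t).prod_prod
        (Measure.measurePreserving_infinitePi_piecewise _
          fun x : Fin S.L × ℕ × ℕ => x.2.1 < t)))

theorem success_splice_of_lt {t s : ℕ} (h : s < t) (z : S.Outcome × S.Outcome) (i : Fin S.L) :
    success (splice t z) i s ↔ success z.1 i s := by simp [success, splice, h]

theorem chunk_splice_of_lt {t s : ℕ} (h : s < t) (z : S.Outcome × S.Outcome) (i : Fin S.L) :
    chunk (splice t z) i s = chunk z.1 i s := by simp [chunk, splice, h]

theorem received_splice {t s : ℕ} (h : s ≤ t) (z : S.Outcome × S.Outcome) (i : Fin S.L)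
    (c : Fin S.q) : received (splice t z) i c s = received z.1 i c s := by
  ext r
  simp only [mem_received]
  refine and_congr_right fun hr => ?_
  rw [success_splice_of_lt (hr.trans_le h), chunk_splice_of_lt (hr.trans_le h)]

theorem packet_splice_of_lt {t s : ℕ} (h : s < t) (z : S.Outcome × S.Outcome) (i : ℕ)
    (hi : i < S.L) : packet (splice t z) i hi s = packet z.1 i hi s := by
  induction i generalizing s with
  | zero => ext j; simp [packet, sourceCoeff, splice, h]
  | succ i ih =>
    rw [packet_eq_freshPacket, packet_eq_freshPacket, chunk_splice_of_lt h]
    simp only [freshPacket, received_splice h.le]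
    refine Finset.sum_congr rfl fun r hr => ?_
    rw [ih ((mem_received.1 hr).1.trans h)]
    simp [coeff, splice, h]

theorem nodeSpan_splice (t : ℕ) (z : S.Outcome × S.Outcome) (c : Fin S.q) (i : ℕ) (h : i ≤ S.L) :
    nodeSpan (splice t z) c t i h = nodeSpan z.1 c t i h := by
  cases i with
  | zero => rfl
  | succ i =>
    simp only [nodeSpan, received_splice le_rfl]
    congr 1
    exact Set.image_congr fun s hs => packet_splice_of_lt (mem_received.1 hs).1 z i h

/-- The packets being combined come from the past, while the coefficients of slot `t` belong to the
redrawn part. -/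
theorem freshPacket_splice (t : ℕ) (z : S.Outcome × S.Outcome) (c : Fin S.q) (i : ℕ)
    (h : i < S.L) :
    freshPacket (splice t z) (splice t z) c t i h = freshPacket z.1 z.2 c t i h := by
  cases i with
  | zero => ext j; simp [freshPacket, sourceCoeff, splice]
  | succ i =>
    simp only [freshPacket, received_splice le_rfl]
    refine Finset.sum_congr rfl fun r hr => ?_
    rw [packet_splice_of_lt (mem_received.1 hr).1]
    simp [coeff, splice]

/-! ### The probability of an innovative reception -/

/-- Given the past `ω`, the fresh randomness makes the transmission over link `i` at slot `t` a
successful transmission of a packet of chunk `c` that is innovative for the receiver. -/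
def Innovative (ω : S.Outcome) (c : Fin S.q) (t i : ℕ) (h : i < S.L) : Set S.Outcome :=
  {ω' | success ω' ⟨i, h⟩ t ∧ chunk ω' ⟨i, h⟩ t = c ∧
    freshPacket ω ω' c t i h ∉ nodeSpan ω c t (i + 1) h}

theorem prob_prod_apply (A : Set (Fin S.L × ℕ → Bool)) (B : Set (Fin S.L × ℕ → Fin S.q))
    (C : Set (ℕ × Fin S.α → ZMod 2)) (D : Set (Fin S.L × ℕ × ℕ → ZMod 2)) :
    S.prob (A ×ˢ B ×ˢ C ×ˢ D) =
      Measure.infinitePi (fun x : Fin S.L × ℕ =>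
        bernoulliMeasure true false ⟨S.p x.1, (S.p_pos x.1).le, S.p_le_one x.1⟩) A *
      (Measure.infinitePi (fun _ : Fin S.L × ℕ => (PMF.uniformOfFintype (Fin S.q)).toMeasure) B *
      (Measure.infinitePi (fun _ : ℕ × Fin S.α => uniformBit) C *
      Measure.infinitePi (fun _ : Fin S.L × ℕ × ℕ => uniformBit) D)) := by
  rw [prob, Measure.prod_prod, Measure.prod_prod, Measure.prod_prod]

theorem infinitePi_success (i : Fin S.L) (t : ℕ) :
    Measure.infinitePi (fun x : Fin S.L × ℕ =>
        bernoulliMeasure true false ⟨S.p x.1, (S.p_pos x.1).le, S.p_le_one x.1⟩)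
      {a | a (i, t) = true} = ENNReal.ofReal (S.p i) := by
  have := (measurePreserving_eval_infinitePi (fun x : Fin S.L × ℕ =>
    bernoulliMeasure true false ⟨S.p x.1, (S.p_pos x.1).le, S.p_le_one x.1⟩) (i, t)).measure_preimage
      (measurableSet_singleton true).nullMeasurableSet
  refine this.trans ?_
  rw [bernoulliMeasure_apply _ (measurableSet_singleton _)]
  simp only [Set.mem_singleton_iff, if_true, reduceCtorEq, if_false, ENNReal.ofReal,
    Real.toNNReal_of_nonneg (S.p_pos i).le]
  rfl

theorem infinitePi_chunk (i : Fin S.L) (t : ℕ) (c : Fin S.q) :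
    Measure.infinitePi (fun _ : Fin S.L × ℕ => (PMF.uniformOfFintype (Fin S.q)).toMeasure)
      {a | a (i, t) = c} = (S.q : ENNReal)⁻¹ := by
  have := (measurePreserving_eval_infinitePi (fun _ : Fin S.L × ℕ =>
    (PMF.uniformOfFintype (Fin S.q)).toMeasure) (i, t)).measure_preimage
      (measurableSet_singleton c).nullMeasurableSet
  refine this.trans ?_
  simp

theorem measurable_sum_smul {ι κ : Type*} {n : ℕ} (R : Finset κ) (j : κ → ι)
    (x : κ → Fin n → ZMod 2) :
    Measurable fun y : ι → ZMod 2 => ∑ s ∈ R, y (j s) • x s := by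
  refine Finset.measurable_sum _ fun s _ => measurable_pi_lambda _ fun l => ?_
  simp only [Pi.smul_apply, smul_eq_mul]
  fun_prop

theorem le_infinitePi_sum_notMem {ι κ : Type*} {n : ℕ} (R : Finset κ)
    (j : κ → ι) (hj : Function.Injective j) (x : κ → Fin n → ZMod 2)
    (W V : Submodule (ZMod 2) (Fin n → ZMod 2)) (hW : W ≤ V)
    (hV : V = Submodule.span (ZMod 2) (x '' R)) :
    1 - 2⁻¹ ^ (Module.finrank (ZMod 2) V - Module.finrank (ZMod 2) W) ≤
      Measure.infinitePi (fun _ : ι => uniformBit) {y | ∑ s ∈ R, y (j s) • x s ∉ W} := by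
  subst hV
  have hm : MeasurableSet {y : ι → ZMod 2 | ∑ s ∈ R, y (j s) • x s ∈ W} :=
    measurable_sum_smul R j x (MeasurableSet.of_discrete (s := (W : Set (Fin n → ZMod 2))))
  have := prob_compl_eq_one_sub (μ := Measure.infinitePi (fun _ : ι => uniformBit)) hm
  refine le_of_le_of_eq ?_ this.symm
  exact tsub_le_tsub_left (infinitePi_uniformBit_sum_mem_le R j hj x W hW) 1

/-- With the past frozen, the event is a rectangle, so its probability factors. Unit vectors stand
in for received packets, which lets one estimate serve the source and the interior nodes. -/
theorem innovative_zero (ω : S.Outcome) (c : Fin S.q) (t : ℕ) (h : 0 < S.L) :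
    Innovative ω c t 0 h = {a | a (⟨0, h⟩, t) = true} ×ˢ {b | b (⟨0, h⟩, t) = c} ×ˢ
      {y | ∑ j ∈ Finset.univ, y (t, j) • (Pi.single j 1 : Fin S.α → ZMod 2) ∉
        nodeSpan ω c t 1 h} ×ˢ Set.univ := by
  ext ω'
  have : freshPacket ω ω' c t 0 h =
      ∑ j, ω'.2.2.1 (t, j) • (Pi.single j 1 : Fin S.α → ZMod 2) := by
    rw [pi_eq_sum_univ' (freshPacket ω ω' c t 0 h)]
    rfl
  simp [Innovative, success, chunk, this]

theorem innovative_succ (ω : S.Outcome) (c : Fin S.q) (t i : ℕ) (h : i + 1 < S.L) :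
    Innovative ω c t (i + 1) h = {a | a (⟨i + 1, h⟩, t) = true} ×ˢ {b | b (⟨i + 1, h⟩, t) = c} ×ˢ
      Set.univ ×ˢ {y | ∑ s ∈ received ω ⟨i, Nat.lt_of_succ_lt h⟩ c t,
        y (⟨i + 1, h⟩, t, s) • packet ω i (Nat.lt_of_succ_lt h) s ∉
        nodeSpan ω c t (i + 1 + 1) h} := by
  ext ω'
  simp [Innovative, success, chunk, freshPacket, coeff]

theorem measurableSet_innovative (ω : S.Outcome) (c : Fin S.q) (t i : ℕ) (h : i < S.L) :
    MeasurableSet (Innovative ω c t i h) := by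
  have h1 (i : Fin S.L) : MeasurableSet {a : Fin S.L × ℕ → Bool | a (i, t) = true} :=
    (by fun_prop : Measurable fun a : Fin S.L × ℕ → Bool => a (i, t)) (measurableSet_singleton true)
  have h2 (i : Fin S.L) : MeasurableSet {a : Fin S.L × ℕ → Fin S.q | a (i, t) = c} :=
    (by fun_prop : Measurable fun a : Fin S.L × ℕ → Fin S.q => a (i, t)) (measurableSet_singleton c)
  cases i with
  | zero =>
    rw [innovative_zero]
    refine (h1 _).prod ((h2 _).prod (MeasurableSet.prod ?_ .univ))
    exact measurable_sum_smul _ _ _ (MeasurableSet.of_discrete (s := {v | v ∉ nodeSpan ω c t 1 h}))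
  | succ i =>
    rw [innovative_succ]
    refine (h1 _).prod ((h2 _).prod (MeasurableSet.univ.prod ?_))
    exact measurable_sum_smul _ (fun s => ((⟨i + 1, h⟩ : Fin S.L), t, s)) _
      (MeasurableSet.of_discrete (s := {v | v ∉ nodeSpan ω c t (i + 1 + 1) h}))

theorem le_prob_innovative (ω : S.Outcome) (c : Fin S.q) (t i : ℕ) (h : i < S.L) :
    ENNReal.ofReal (S.p ⟨i, h⟩) * ((S.q : ENNReal)⁻¹ *
      (1 - 2⁻¹ ^ (nodeRank ω c t i h.le - nodeRank ω c t (i + 1) h))) ≤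
      S.prob (Innovative ω c t i h) := by
  cases i with
  | zero =>
    rw [innovative_zero, prob_prod_apply, infinitePi_success, infinitePi_chunk, measure_univ,
      mul_one]
    gcongr
    refine le_infinitePi_sum_notMem Finset.univ _ (Prod.mk_right_injective t) _ _ _
      (nodeSpan_succ_le ω c t 0 h) ?_
    rw [Finset.coe_univ, Set.image_univ]
    have := (Pi.basisFun (ZMod 2) (Fin S.α)).span_eq
    simp only [nodeSpan, ← this]
    congr 2
    ext j : 1
    simp
  | succ i =>
    rw [innovative_succ, prob_prod_apply, infinitePi_success, infinitePi_chunk, measure_univ,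
      one_mul]
    gcongr
    exact le_infinitePi_sum_notMem _ (fun s => ((⟨i + 1, h⟩ : Fin S.L), t, s))
      (fun s s' hs => by simpa using hs) _ _ _ (nodeSpan_succ_le ω c t (i + 1) h) rfl

theorem le_prob_real_innovative (ω : S.Outcome) (c : Fin S.q) (t i : ℕ) (h : i < S.L) :
    S.p ⟨i, h⟩ / S.q * (1 - 2⁻¹ ^ (nodeRank ω c t i h.le - nodeRank ω c t (i + 1) h)) ≤
      S.prob.real (Innovative ω c t i h) := by
  refine le_of_eq_of_le ?_ (ENNReal.toReal_mono (measure_ne_top _ _)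
    (le_prob_innovative ω c t i h))
  rw [ENNReal.toReal_mul, ENNReal.toReal_mul, ENNReal.toReal_ofReal (S.p_pos _).le,
    ENNReal.toReal_sub_of_le (pow_le_one₀ (by simp) (by simp)) (by simp)]
  simp [div_eq_mul_inv, mul_assoc]

/-! ### Exponential moments of the ranks -/

/-- An innovative reception gains at least one factor `x`; otherwise monotonicity of the rank
suffices. -/
theorem pow_nodeRank_splice_le {x : ℝ} (hx0 : 0 ≤ x) (hx1 : x ≤ 1) (z : S.Outcome × S.Outcome)
    (c : Fin S.q) (t i : ℕ) (h : i < S.L) :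
    x ^ nodeRank (splice t z) c (t + 1) (i + 1) h ≤
      x ^ nodeRank z.1 c t (i + 1) h *
        (1 - (Innovative z.1 c t i h).indicator (fun _ => 1 - x) z.2) := by
  have hr : nodeRank (splice t z) c t (i + 1) h = nodeRank z.1 c t (i + 1) h := by
    rw [nodeRank, nodeSpan_splice, nodeRank]
  by_cases hz : z.2 ∈ Innovative z.1 c t i h
  · rw [Set.indicator_of_mem hz, sub_sub_cancel, ← pow_succ, ← hr]
    obtain ⟨h1, h2, h3⟩ := hz
    refine pow_le_pow_of_le_one hx0 hx1 (nodeRank_lt_of_notMem (h := h) ?_ ?_ ?_)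
    · simpa [success, splice] using h1
    · simpa [chunk, splice] using h2
    · have hc : chunk (splice t z) ⟨i, h⟩ t = c := by simpa [chunk, splice] using h2
      rwa [packet_eq_freshPacket, freshPacket_splice, nodeSpan_splice, hc]
  · rw [Set.indicator_of_notMem hz, sub_zero, mul_one, ← hr]
    exact pow_le_pow_of_le_one hx0 hx1 (nodeRank_slot_mono _ c t _ h)

theorem measurable_pow_nodeRank (x : ℝ) (c : Fin S.q) (t i : ℕ) (h : i ≤ S.L) :
    Measurable fun ω : S.Outcome => x ^ nodeRank ω c t i h :=
  (Measurable.of_discrete (f := fun n : ℕ => x ^ n)).comp (measurable_nodeRank c t i h)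

theorem integrable_pow_nodeRank {x : ℝ} (hx0 : 0 ≤ x) (hx1 : x ≤ 1) (c : Fin S.q) (t i : ℕ)
    (h : i ≤ S.L) : Integrable (fun ω : S.Outcome => x ^ nodeRank ω c t i h) S.prob :=
  .of_bound (measurable_pow_nodeRank x c t i h).aestronglyMeasurable 1 <| .of_forall fun ω => by
    rw [Real.norm_of_nonneg (by positivity)]
    exact pow_le_one₀ hx0 hx1

/-- The linearising step: `1 / 2 ≤ x` allows 2^(-d) to be replaced by x^d for the rank gap d, after
which the two ranks enter only through their own powers of `x`. -/
theorem integral_pow_nodeRank_splice_le {x : ℝ} (hx0 : 1 / 2 ≤ x) (hx1 : x ≤ 1) (ω : S.Outcome)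
    (c : Fin S.q) (t i : ℕ) (h : i < S.L) :
    ∫ ω', x ^ nodeRank (splice t (ω, ω')) c (t + 1) (i + 1) h ∂S.prob ≤
      (1 - S.p ⟨i, h⟩ / S.q * (1 - x)) * x ^ nodeRank ω c t (i + 1) h +
        S.p ⟨i, h⟩ / S.q * (1 - x) * x ^ nodeRank ω c t i h.le := by
  have hx : 0 ≤ x := by linarith
  have hE := measurableSet_innovative ω c t i h
  have hint : Integrable (fun ω' => x ^ nodeRank ω c t (i + 1) h *
      (1 - (Innovative ω c t i h).indicator (fun _ => 1 - x) ω')) S.prob :=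
    ((integrable_const _).sub ((integrable_const _).indicator hE)).const_mul _
  have h1 : ∫ ω', x ^ nodeRank (splice t (ω, ω')) c (t + 1) (i + 1) h ∂S.prob ≤
      ∫ ω', x ^ nodeRank ω c t (i + 1) h *
        (1 - (Innovative ω c t i h).indicator (fun _ => 1 - x) ω') ∂S.prob :=
    integral_mono_of_nonneg (.of_forall fun ω' => by positivity) hint
      (.of_forall fun ω' => pow_nodeRank_splice_le hx hx1 (ω, ω') c t i h)
  refine h1.trans ?_
  rw [integral_const_mul, integral_sub (integrable_const _) ((integrable_const _).indicator hE),
    integral_indicator_const _ hE, integral_const, probReal_univ, smul_eq_mul, smul_eq_mul, one_mul]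
  have h2 := le_prob_real_innovative ω c t i h
  obtain ⟨d, hd⟩ := Nat.exists_eq_add_of_le (nodeRank_succ_le ω c t i h)
  rw [hd, Nat.add_sub_cancel_left] at h2
  rw [hd, pow_add]
  have h3 : (2⁻¹ : ℝ) ^ d ≤ x ^ d := pow_le_pow_left₀ (by norm_num) (by linarith) d
  have h4 : 0 ≤ S.p ⟨i, h⟩ / S.q := div_nonneg (S.p_pos _).le (Nat.cast_nonneg _)
  have h5 : S.p ⟨i, h⟩ / S.q * (1 - x ^ d) ≤ S.prob.real (Innovative ω c t i h) :=
    (mul_le_mul_of_nonneg_left (by linarith) h4).trans h2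
  have h6 : 0 ≤ x ^ nodeRank ω c t (i + 1) h := by positivity
  have h7 := mul_le_mul_of_nonneg_right (mul_le_mul_of_nonneg_left h5 h6) (sub_nonneg.2 hx1)
  linarith

/-- The recursion for the exponential moments of the ranks of consecutive nodes. -/
theorem integral_pow_nodeRank_succ_le {x : ℝ} (hx0 : 1 / 2 ≤ x) (hx1 : x ≤ 1)
    (c : Fin S.q) (t i : ℕ) (h : i < S.L) :
    ∫ ω, x ^ nodeRank ω c (t + 1) (i + 1) h ∂S.prob ≤
      (1 - S.p ⟨i, h⟩ / S.q * (1 - x)) * ∫ ω, x ^ nodeRank ω c t (i + 1) h ∂S.prob +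
        S.p ⟨i, h⟩ / S.q * (1 - x) * ∫ ω, x ^ nodeRank ω c t i h.le ∂S.prob := by
  have hx : 0 ≤ x := by linarith
  have hmp := measurePreserving_splice (S := S) t
  have hI := integrable_pow_nodeRank hx hx1 c (t + 1) (i + 1) h
  -- Redraw the future and apply Fubini; the inner integral acts as the conditional expectation
  -- given the past.
  have h1 : ∫ ω, x ^ nodeRank ω c (t + 1) (i + 1) h ∂S.prob =
      ∫ ω, ∫ ω', x ^ nodeRank (splice t (ω, ω')) c (t + 1) (i + 1) h ∂S.prob ∂S.prob := by
    refine Eq.trans ?_ (integral_prod _ (hmp.integrable_comp_of_integrable hI))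
    conv_lhs => rw [← hmp.map_eq]
    exact integral_map hmp.aemeasurable
      (measurable_pow_nodeRank x c (t + 1) (i + 1) h).aestronglyMeasurable
  have hi1 := (integrable_pow_nodeRank hx hx1 c t (i + 1) h).const_mul
    (1 - S.p ⟨i, h⟩ / S.q * (1 - x))
  have hi2 := (integrable_pow_nodeRank hx hx1 c t i h.le).const_mul
    (S.p ⟨i, h⟩ / S.q * (1 - x))
  rw [h1, ← integral_const_mul, ← integral_const_mul, ← integral_add hi1 hi2]
  exact integral_mono_of_nonneg (.of_forall fun ω => integral_nonneg fun ω' => by positivity)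
    (hi1.add hi2) (.of_forall fun ω => integral_pow_nodeRank_splice_le hx0 hx1 ω c t i h)

theorem pMin_le (i : Fin S.L) : S.pMin ≤ S.p i := ciInf_le (Set.finite_range _).bddBelow i

theorem pMin_pos (S : ChunkedLine) : 0 < S.pMin := by
  have : Nonempty (Fin S.L) := ⟨⟨0, S.L_pos⟩⟩
  obtain ⟨i, hi⟩ := exists_eq_ciInf_of_finite (f := S.p)
  rw [pMin, ← hi]
  exact S.p_pos i

theorem pMin_le_one (S : ChunkedLine) : S.pMin ≤ 1 :=
  (pMin_le ⟨0, S.L_pos⟩).trans (S.p_le_one _)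

theorem q_cast_pos (S : ChunkedLine) : (0 : ℝ) < S.q := Nat.cast_pos.2 S.q_pos

theorem one_le_q_cast (S : ChunkedLine) : (1 : ℝ) ≤ S.q := Nat.one_le_cast.2 S.q_pos

theorem one_le_L_cast (S : ChunkedLine) : (1 : ℝ) ≤ S.L := Nat.one_le_cast.2 S.L_pos

/-- The constant x^α solves the recursion, so the excess obeys it too. It vanishes at the source and
is at most 1 ≤ A^i at time 0. The right side is a supersolution because (1 - κ) + κ/A = 1 - κ(1 -
1/A) ≤ ρ for each link. -/
theorem integral_pow_nodeRank_le {x A : ℝ} (hx0 : 1 / 2 ≤ x) (hx1 : x ≤ 1) (hA : 1 ≤ A)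
    (c : Fin S.q) (t i : ℕ) (h : i ≤ S.L) :
    ∫ ω, x ^ nodeRank ω c t i h ∂S.prob - x ^ S.α ≤
      A ^ i * (1 - S.pMin / S.q * (1 - x) * (1 - A⁻¹)) ^ t := by
  have hx : 0 ≤ x := by linarith
  have hA0 : 0 < A := by linarith
  have hAi : A⁻¹ ≤ 1 := inv_le_one_of_one_le₀ hA
  have hAi0 : 0 < A⁻¹ := by positivity
  have hp := S.pMin_pos
  have hq := S.q_cast_pos
  have hpq : S.pMin / S.q ≤ 1 :=
    (div_le_one hq).2 (S.pMin_le_one.trans S.one_le_q_cast)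
  have hb : 0 ≤ (1 - x) * (1 - A⁻¹) := mul_nonneg (by linarith) (by linarith)
  have hb1 : (1 - x) * (1 - A⁻¹) ≤ 1 := mul_le_one₀ (by linarith) (by linarith) (by linarith)
  have hρ : 0 ≤ 1 - S.pMin / S.q * (1 - x) * (1 - A⁻¹) := by
    rw [mul_assoc]
    linarith [mul_le_one₀ hpq hb hb1]
  set ρ := 1 - S.pMin / S.q * (1 - x) * (1 - A⁻¹) with hρdef
  induction t generalizing i with
  | zero =>
    have : ∫ ω, x ^ nodeRank ω c 0 i h ∂S.prob ≤ ∫ _, (1 : ℝ) ∂S.prob :=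
      integral_mono (integrable_pow_nodeRank hx hx1 c 0 i h) (integrable_const _)
        fun ω => pow_le_one₀ hx hx1
    rw [integral_const, probReal_univ, one_smul] at this
    have h2 : 0 ≤ x ^ S.α := by positivity
    rw [pow_zero, mul_one]
    linarith [one_le_pow₀ (n := i) hA]
  | succ t ih =>
    cases i with
    | zero =>
      simp only [nodeRank_zero, integral_const, probReal_univ, one_smul, sub_self]
      positivity
    | succ i =>
      have h1 := integral_pow_nodeRank_succ_le hx0 hx1 c t i h
      have h2 := ih (i + 1) h
      have h3 := ih i (Nat.le_of_succ_le h)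
      set κ := S.p ⟨i, h⟩ / S.q * (1 - x) with hκ
      have hp1 : S.p ⟨i, h⟩ / S.q ≤ 1 :=
        (div_le_one hq).2 ((S.p_le_one _).trans S.one_le_q_cast)
      have hκ0 : 0 ≤ κ := mul_nonneg (div_nonneg (S.p_pos _).le hq.le) (by linarith)
      have hκ1 : κ ≤ 1 := mul_le_one₀ hp1 (by linarith) (by linarith)
      have hle : S.pMin / S.q * (1 - x) ≤ κ :=
        mul_le_mul_of_nonneg_right (div_le_div_of_nonneg_right (pMin_le _) hq.le) (by linarith)
      have h4 : 1 - κ * (1 - A⁻¹) ≤ ρ := by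
        have := mul_le_mul_of_nonneg_right hle (sub_nonneg.2 hAi)
        linarith
      have h5 : 0 ≤ A ^ (i + 1) * ρ ^ t := by positivity
      have h6 : A ^ i * ρ ^ t = A⁻¹ * (A ^ (i + 1) * ρ ^ t) := by
        rw [pow_succ]; field_simp
      calc _ ≤ (1 - κ) * (A ^ (i + 1) * ρ ^ t) + κ * (A ^ i * ρ ^ t) := by
            nlinarith [mul_le_mul_of_nonneg_left h2 (sub_nonneg.2 hκ1),
              mul_le_mul_of_nonneg_left h3 hκ0]
        _ = (1 - κ * (1 - A⁻¹)) * (A ^ (i + 1) * ρ ^ t) := by rw [h6]; ring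
        _ ≤ ρ * (A ^ (i + 1) * ρ ^ t) := mul_le_mul_of_nonneg_right h4 h5
        _ = A ^ (i + 1) * ρ ^ (t + 1) := by ring

/-! ### The tail of the coding delay -/

theorem prob_not_decodesChunk_le {x A : ℝ} (hx0 : 1 / 2 ≤ x) (hx1 : x < 1) (hA : 1 ≤ A)
    (c : Fin S.q) (n : ℕ) :
    S.prob {ω | ¬ DecodesChunk ω c n} ≤ ENNReal.ofReal
      (A ^ S.L * (1 - S.pMin / S.q * (1 - x) * (1 - A⁻¹)) ^ n / (x ^ S.α * (1 - x))) := by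
  have hx : 0 < x := by linarith
  have hI := integrable_pow_nodeRank hx.le hx1.le c n S.L le_rfl
  have hc : 0 < x ^ S.α * (1 - x) := mul_pos (by positivity) (by linarith)
  have hsub : {ω : S.Outcome | ¬ DecodesChunk ω c n} ⊆
      {ω | x ^ S.α * (1 - x) ≤ x ^ nodeRank ω c n S.L le_rfl - x ^ S.α} := by
    intro ω hω
    have hlt : nodeRank ω c n S.L le_rfl < S.α :=
      (nodeRank_le ω c n S.L le_rfl).lt_of_ne fun he => hω (decodesChunk_of_nodeRank_eq he)
    have h1 := pow_le_pow_of_le_one hx.le hx1.le (Nat.succ_le_of_lt hlt)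
    rw [Nat.succ_eq_add_one, pow_succ] at h1
    have h2 : x ^ nodeRank ω c n S.L le_rfl ≤ 1 := pow_le_one₀ hx.le hx1.le
    have h3 : 0 < x ^ nodeRank ω c n S.L le_rfl := by positivity
    simp only [Set.mem_ofPred_eq]
    -- With r the rank, x^α (2 - x) ≤ x^r · x(2 - x) = x^r (1 - (1 - x)²) ≤ x^r.
    nlinarith [mul_nonneg h3.le (sq_nonneg (1 - x)),
      mul_le_mul_of_nonneg_right h1 (by linarith : 0 ≤ 2 - x)]
  have h1 := mul_meas_ge_le_integral_of_nonneg (μ := S.prob)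
    (f := fun ω => x ^ nodeRank ω c n S.L le_rfl - x ^ S.α) (.of_forall fun ω =>
      sub_nonneg.2 (pow_le_pow_of_le_one hx.le hx1.le (nodeRank_le ω c n S.L le_rfl)))
    (hI.sub (integrable_const _)) (x ^ S.α * (1 - x))
  rw [integral_sub hI (integrable_const _), integral_const, probReal_univ, one_smul] at h1
  have h2 := h1.trans (integral_pow_nodeRank_le hx0 hx1.le hA c n S.L le_rfl)
  refine (measure_mono hsub).trans ?_
  rw [← ofReal_measureReal]
  exact ENNReal.ofReal_le_ofReal ((le_div_iff₀' hc).2 h2)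

/-- If the delay exceeds `N`, some chunk is still undecoded at time `⌊N⌋₊`; sum over the chunks. -/
theorem probDelayGT_le {x A : ℝ} (hx0 : 1 / 2 ≤ x) (hx1 : x < 1) (hA : 1 ≤ A) (N : ℝ) :
    S.probDelayGT N ≤ ENNReal.ofReal (S.q *
      (A ^ S.L * (1 - S.pMin / S.q * (1 - x) * (1 - A⁻¹)) ^ ⌊N⌋₊ / (x ^ S.α * (1 - x)))) := by
  have hsub : {ω : S.Outcome | ENNReal.ofReal N < (codingDelay ω : ENNReal)} ⊆
      ⋃ c, {ω | ¬ DecodesChunk ω c ⌊N⌋₊} := by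
    intro ω hω
    by_contra hcon
    simp only [Set.mem_iUnion, Set.mem_ofPred_eq, not_exists, not_not] at hcon hω
    have h1 : codingDelay ω ≤ (⌊N⌋₊ : ℕ∞) := iInf₂_le _ hcon
    refine absurd hω (not_lt.2 ?_)
    calc (codingDelay ω : ENNReal) ≤ ((⌊N⌋₊ : ℕ∞) : ENNReal) := by exact_mod_cast h1
      _ = ENNReal.ofReal (⌊N⌋₊ : ℝ) := by simp
      _ ≤ ENNReal.ofReal N := by
        rcases le_or_gt 0 N with h | h
        · exact ENNReal.ofReal_le_ofReal (Nat.floor_le h)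
        · simp [Nat.floor_of_nonpos h.le]
  refine (measure_mono hsub).trans ((measure_iUnion_le _).trans ?_)
  rw [tsum_fintype]
  refine (Finset.sum_le_sum fun c _ => prob_not_decodesChunk_le hx0 hx1 hA c _).trans ?_
  rw [Finset.sum_const, Finset.card_univ, Fintype.card_fin, nsmul_eq_mul,
    ENNReal.ofReal_mul (Nat.cast_nonneg _), ENNReal.ofReal_natCast]

/-! ### The bound for a single network -/

/-- The binary logarithm of `k L / ε`. -/
noncomputable def logSize (S : ChunkedLine) (ε : ℝ) : ℝ := Real.logb 2 (S.k * S.L / ε)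

variable {ε : ℝ}

theorem le_logSize_of_le {y : ℝ} (hy : 1 ≤ y) (h : y ≤ S.k * S.L / ε) :
    Real.log y ≤ S.logSize ε := by
  have h1 : Real.log y ≤ Real.log (S.k * S.L / ε) := Real.log_le_log (by linarith) h
  have h2 : 0 ≤ Real.log (S.k * S.L / ε) := Real.log_nonneg (hy.trans h)
  refine h1.trans ?_
  rw [logSize, Real.logb, le_div_iff₀ (Real.log_pos one_lt_two)]
  -- Since log 2 < 1, the binary logarithm dominates the natural one.
  nlinarith [Real.log_two_lt_d9]

theorem k_cast (S : ChunkedLine) : (S.k : ℝ) = S.q * S.α := by simp [k]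

theorem α_cast_pos (hk : 2 ≤ S.k) : (1 : ℝ) ≤ S.α := by
  refine Nat.one_le_cast.2 (Nat.pos_of_ne_zero fun h => ?_)
  simp [k, h] at hk

theorem k_mul_L_le (hε0 : 0 < ε) (hε1 : ε < 1) : (S.k : ℝ) * S.L ≤ S.k * S.L / ε :=
  le_div_self (by positivity) hε0 hε1.le

theorem k_le (hε0 : 0 < ε) (hε1 : ε < 1) : (S.k : ℝ) ≤ S.k * S.L / ε :=
  (le_mul_of_one_le_right (Nat.cast_nonneg _) S.one_le_L_cast).trans (k_mul_L_le hε0 hε1)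

theorem q_le_k (hk : 2 ≤ S.k) : (S.q : ℝ) ≤ S.k := by
  rw [k_cast]; exact le_mul_of_one_le_right (Nat.cast_nonneg _) (α_cast_pos hk)

theorem α_le_k : (S.α : ℝ) ≤ S.k := by
  rw [k_cast]; exact le_mul_of_one_le_left (Nat.cast_nonneg _) S.one_le_q_cast

theorem one_le_logSize (hε0 : 0 < ε) (hε1 : ε < 1) (hk : 2 ≤ S.k) : 1 ≤ S.logSize ε := by
  have h2 : (2 : ℝ) ≤ S.k := by exact_mod_cast hk
  have h : (2 : ℝ) ≤ S.k * S.L / ε := h2.trans (k_le hε0 hε1)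
  rw [logSize, Real.le_logb_iff_rpow_le one_lt_two (by linarith)]
  simpa using h

theorem one_div_eps_le (hε0 : 0 < ε) (hk : 2 ≤ S.k) : 1 / ε ≤ S.k * S.L / ε := by
  have h2 : (2 : ℝ) ≤ S.k := by exact_mod_cast hk
  exact div_le_div_of_nonneg_right (one_le_mul_of_one_le_of_one_le (by linarith)
    S.one_le_L_cast) hε0.le

/-- If the chunks have size `b⁶ L log (k L / ε)`, then an overhead of a fraction `1 / (2 b²)` is
sufficient. -/
theorem probDelayGT_le_of_chunkSize {b N : ℝ} (hε0 : 0 < ε) (hε1 : ε < 1) (hk : 2 ≤ S.k)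
    (hb : 28 ≤ b) (hα : S.α = b ^ 6 * (S.L * S.logSize ε))
    (hN : S.q * (S.α + S.α / (2 * b ^ 2)) ≤ S.pMin * N) :
    S.probDelayGT N ≤ ENNReal.ofReal ε := by
  set Λ := S.logSize ε with hΛ
  have hΛ1 : 1 ≤ Λ := one_le_logSize hε0 hε1 hk
  have hL := S.one_le_L_cast
  have hq := S.q_cast_pos
  have hp := S.pMin_pos
  have hα1 := α_cast_pos hk
  have hb0 : 0 < b := by linarith
  have hb3 : 28 ≤ b ^ 3 := hb.trans (le_self_pow₀ (by linarith) (by norm_num))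
  -- Chosen so that θ²α = LΛ. The second-order loss 2θ²α is then 2LΛ, while the overhead gains about
  -- θα/(2b²) = (b/2)LΛ, which wins for large b. Taking A = 1/θ makes 1 - 1/A = 1 - θ.
  set θ : ℝ := (b ^ 3)⁻¹ with hθ
  have hθ0 : 0 < θ := by positivity
  have hθ1 : θ ≤ 1 / 28 := by
    rw [hθ, ← one_div]; exact one_div_le_one_div_of_le (by norm_num) hb3
  set x := Real.exp (-θ) with hx
  have hx1 : x < 1 := (Real.exp_lt_exp.2 (by linarith)).trans_eq Real.exp_zero
  have hx0 : 1 / 2 ≤ x := by have := Real.add_one_le_exp (-θ); linarith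
  have hx2 : θ * (1 - θ) ≤ 1 - x := by
    have h1 : x * (1 + θ) ≤ 1 := by
      have := mul_le_mul_of_nonneg_left (Real.add_one_le_exp θ) (Real.exp_pos (-θ)).le
      rw [← Real.exp_add, neg_add_cancel, Real.exp_zero] at this
      linarith
    have h2 := mul_le_mul_of_nonneg_left (Real.add_one_le_exp (-θ)) hθ0.le
    linarith
  refine (probDelayGT_le hx0 hx1 (A := b ^ 3) (by linarith) N).trans
    (ENNReal.ofReal_le_ofReal ?_)
  set κ := S.pMin / S.q * (1 - x) * (1 - θ) with hκ
  have hpq0 : 0 < S.pMin / S.q := by positivity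
  have hpq1 : S.pMin / S.q ≤ 1 := (div_le_one hq).2 (S.pMin_le_one.trans S.one_le_q_cast)
  have hκ1 : κ ≤ 1 := mul_le_one₀ (mul_le_one₀ hpq1 (by linarith) (by linarith))
    (by linarith) (by linarith)
  have hκ0 : S.pMin / S.q * (θ * (1 - 2 * θ)) ≤ κ := by
    rw [hκ, mul_assoc]
    refine mul_le_mul_of_nonneg_left ?_ hpq0.le
    nlinarith [mul_le_mul_of_nonneg_right hx2 (by linarith : 0 ≤ 1 - θ),
      mul_nonneg hθ0.le (sq_nonneg θ)]
  have hκpos : 0 ≤ κ := le_trans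
    (mul_nonneg hpq0.le (mul_nonneg hθ0.le (by linarith))) hκ0
  have hN0 : 0 ≤ N := by
    refine nonneg_of_mul_nonneg_right (le_trans ?_ hN) hp
    positivity
  have hκN : θ * (1 - 2 * θ) * (S.α + S.α / (2 * b ^ 2)) ≤ κ * N := by
    have h1 : S.α + S.α / (2 * b ^ 2) ≤ S.pMin / S.q * N := by
      rw [div_mul_eq_mul_div, le_div_iff₀ hq]; linarith
    calc _ ≤ θ * (1 - 2 * θ) * (S.pMin / S.q * N) :=
          mul_le_mul_of_nonneg_left h1 (mul_nonneg hθ0.le (by linarith))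
      _ = S.pMin / S.q * (θ * (1 - 2 * θ)) * N := by ring
      _ ≤ κ * N := mul_le_mul_of_nonneg_right hκ0 hN0
  -- Rounding the time down costs at most κ ≤ 1 in the exponent.
  have hfl : κ * N - 1 ≤ κ * ⌊N⌋₊ := by
    have := mul_le_mul_of_nonneg_left (Nat.lt_floor_add_one N).le hκpos
    linarith
  have hρ : (1 - κ) ^ ⌊N⌋₊ ≤ Real.exp (-(κ * N - 1)) := by
    calc (1 - κ) ^ ⌊N⌋₊ ≤ Real.exp (-κ) ^ ⌊N⌋₊ :=
          pow_le_pow_left₀ (by linarith) (by linarith [Real.add_one_le_exp (-κ)]) _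
      _ = Real.exp (-(κ * ⌊N⌋₊)) := by rw [← Real.exp_nat_mul]; ring_nf
      _ ≤ _ := Real.exp_le_exp.2 (by linarith)
  have hqexp : (S.q : ℝ) = Real.exp (Real.log S.q) := (Real.exp_log hq).symm
  have hAexp : (b ^ 3) ^ S.L = Real.exp (S.L * (3 * Real.log b)) := by
    rw [Real.exp_nat_mul, show (3 : ℝ) = (3 : ℕ) by norm_num, Real.exp_nat_mul, Real.exp_log hb0]
  have hxexp : Real.exp (-(θ * S.α) - (1 + 3 * Real.log b)) ≤ x ^ S.α * (1 - x) := by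
    rw [sub_eq_add_neg, Real.exp_add]
    refine mul_le_mul (le_of_eq ?_) ?_ (Real.exp_pos _).le (by positivity)
    · rw [hx, ← Real.exp_nat_mul]; ring_nf
    · have h1 : Real.exp (3 * Real.log b) = b ^ 3 := by
        rw [show (3 : ℝ) = (3 : ℕ) by norm_num, Real.exp_nat_mul, Real.exp_log hb0]
      rw [Real.exp_neg, Real.exp_add, h1, mul_inv, ← hθ]
      have h2 : (Real.exp 1)⁻¹ ≤ 1 / 2 := by
        rw [← one_div]
        exact one_div_le_one_div_of_le (by norm_num) (by linarith [Real.add_one_le_exp 1])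
      have h3 := mul_le_mul_of_nonneg_right h2 hθ0.le
      have h4 := mul_le_mul_of_nonneg_left (by linarith : 1 / 2 ≤ 1 - θ) hθ0.le
      linarith
  have hθα : θ * S.α = b ^ 3 * (S.L * Λ) := by
    rw [hα, hθ]; field_simp
  have hlogq : Real.log S.q ≤ Λ :=
    le_logSize_of_le S.one_le_q_cast ((q_le_k hk).trans (k_le hε0 hε1))
  have hlogε : -Real.log ε ≤ Λ := by
    rw [← Real.log_inv, ← one_div]
    exact le_logSize_of_le ((one_le_div hε0).2 hε1.le) (one_div_eps_le hε0 hk)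
  have hLΛ : Λ ≤ S.L * Λ := le_mul_of_one_le_left (by linarith) hL
  have hlogb : 6 * Real.log b ≤ Λ := by
    have h1 : b ^ 6 ≤ S.α := by
      rw [hα]; exact le_mul_of_one_le_right (by positivity) (by linarith)
    have h2 := le_logSize_of_le (S := S) (ε := ε) (one_le_pow₀ (by linarith : 1 ≤ b) (n := 6))
      (h1.trans (α_le_k.trans (k_le hε0 hε1)))
    rw [Real.log_pow] at h2
    exact_mod_cast h2
  have hmain : θ * S.α - θ * (1 - 2 * θ) * (S.α + S.α / (2 * b ^ 2)) ≤
      (2 - b / 4) * (S.L * Λ) := by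
    have h1 : θ * S.α - θ * (1 - 2 * θ) * (S.α + S.α / (2 * b ^ 2)) =
        (2 - (1 - 2 * θ) * b / 2) * (S.L * Λ) := by
      rw [hα, hθ]; field_simp; ring
    rw [h1]
    refine mul_le_mul_of_nonneg_right ?_ (by linarith)
    have := mul_le_mul_of_nonneg_right (by linarith : 1 / 2 ≤ 1 - 2 * θ) hb0.le
    linarith
  calc _ ≤ Real.exp (Real.log S.q) * (Real.exp (S.L * (3 * Real.log b)) *
        Real.exp (-(κ * N - 1)) / Real.exp (-(θ * S.α) - (1 + 3 * Real.log b))) := by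
        rw [← hqexp, hAexp]
        refine mul_le_mul_of_nonneg_left ?_ hq.le
        exact div_le_div₀ (by positivity) (mul_le_mul_of_nonneg_left hρ (Real.exp_pos _).le)
          (Real.exp_pos _) hxexp
    _ = Real.exp (Real.log S.q + (S.L * (3 * Real.log b) + -(κ * N - 1) -
        (-(θ * S.α) - (1 + 3 * Real.log b)))) := by
        rw [← Real.exp_add, ← Real.exp_sub, ← Real.exp_add]
    _ ≤ Real.exp (Real.log ε) := by
        -- The budget is 5LΛ: one LΛ each for log q, for -log ε, for the rounding and for the
        -- constant 1, and one half each for 3L log b and 3 log b. The threshold `28 ≤ b` is what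
        -- makes 2 - b/4 ≤ -5.
        refine Real.exp_le_exp.2 ?_
        have h1 : (S.L : ℝ) * (6 * Real.log b) ≤ S.L * Λ :=
          mul_le_mul_of_nonneg_left hlogb (by linarith)
        have h2 : (2 - b / 4) * (S.L * Λ) ≤ (-5) * (S.L * Λ) :=
          mul_le_mul_of_nonneg_right (by linarith) (by linarith)
        linarith
    _ = ε := Real.exp_log hε0

theorem delayBound_zero_sub_capacity_div {w : ℝ} (hk : 2 ≤ S.k) (hw : 0 < w) :
    (S.delayBound ε w 0 - S.capacity) / S.capacity = S.L / w +
      √(w * Real.logb 2 (w * S.q * S.L / ε) / S.α) +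
      w * Real.logb 2 (w * S.q * S.L / ε) / S.α := by
  have hα := α_cast_pos hk
  have hq := S.q_cast_pos
  have hp := S.pMin_pos
  have hs : √(S.k * (w * S.q * Real.logb 2 (w * S.q * S.L / ε))) =
      S.k * √(w * Real.logb 2 (w * S.q * S.L / ε) / S.α) := by
    rw [← Real.sqrt_sq (Nat.cast_nonneg (α := ℝ) S.k), ← Real.sqrt_mul (sq_nonneg _),
      Real.sqrt_sq (Nat.cast_nonneg (α := ℝ) S.k), k_cast]
    congr 1
    field_simp
  rw [delayBound, capacity, hs, k_cast]
  field_simp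
  ring

theorem logb_slice_nonneg {w : ℝ} (hε0 : 0 < ε) (hε1 : ε < 1) (hw : 1 ≤ w) :
    0 ≤ Real.logb 2 (w * S.q * S.L / ε) := by
  refine Real.logb_nonneg one_lt_two ((one_le_div hε0).2 (hε1.le.trans ?_))
  exact one_le_mul_of_one_le_of_one_le
    (one_le_mul_of_one_le_of_one_le hw S.one_le_q_cast) S.one_le_L_cast

theorem logb_slice_le {b w : ℝ} (hε0 : 0 < ε) (hε1 : ε < 1) (hk : 2 ≤ S.k)
    (hb : 1 ≤ b) (hα : S.α = b ^ 6 * (S.L * S.logSize ε)) (hw0 : 0 < w)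
    (hw : w ≤ 2 * (S.L * b ^ 2)) :
    Real.logb 2 (w * S.q * S.L / ε) ≤ 2 * S.logSize ε := by
  have hΛ1 : 1 ≤ S.logSize ε := one_le_logSize hε0 hε1 hk
  have hL := S.one_le_L_cast
  have hq := S.q_cast_pos
  have h2 : (2 : ℝ) ≤ S.k := by exact_mod_cast hk
  have hb2 : b ^ 2 ≤ S.α := by
    rw [hα]
    exact (pow_le_pow_right₀ hb (by norm_num)).trans (le_mul_of_one_le_right (by positivity)
      (one_le_mul_of_one_le_of_one_le hL hΛ1))
  -- A polynomial comparison costs only the factor 2 in the logarithm; it uses b² ≤ α, 2 ≤ k and ε²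
  -- ≤ ε.
  have h1 : w * S.q * S.L / ε ≤ (S.k * S.L / ε) ^ 2 := by
    rw [div_pow, div_le_div_iff₀ hε0 (by positivity)]
    have h3 : w * S.q * S.L ≤ (S.k * S.L) ^ 2 := by
      calc w * S.q * S.L ≤ 2 * (S.L * S.α) * S.q * S.L := by gcongr; nlinarith
        _ = 2 * S.k * S.L ^ 2 := by rw [k_cast]; ring
        _ ≤ S.k * S.k * S.L ^ 2 := by gcongr
        _ = _ := by ring
    have h4 : ε ^ 2 ≤ ε := by nlinarith
    exact mul_le_mul h3 h4 (by positivity) (by positivity)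
  have h5 := Real.logb_le_logb_of_le one_lt_two (by positivity) h1
  rwa [Real.logb_pow, Nat.cast_ofNat] at h5

/-- For w of order L b², the terms L/w and the square root are both at most 2/b²: this balance
explains the cube root in the choice of w. The last term is at most the square (2/b²)². -/
theorem overhead_le {b w : ℝ} (hε0 : 0 < ε) (hε1 : ε < 1) (hk : 2 ≤ S.k)
    (hb : 28 ≤ b) (hα : S.α = b ^ 6 * (S.L * S.logSize ε))
    (hw0 : 1 / 2 * (S.L * b ^ 2) ≤ w) (hw : w ≤ 2 * (S.L * b ^ 2)) :
    (S.delayBound ε w 0 - S.capacity) / S.capacity ≤ 8 / b ^ 2 := by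
  have hΛ1 : 1 ≤ S.logSize ε := one_le_logSize hε0 hε1 hk
  have hL := S.one_le_L_cast
  have hb0 : 0 < b := by linarith
  have hb2 : 1 ≤ b ^ 2 := one_le_pow₀ (by linarith)
  have hLb : 0 < S.L * b ^ 2 := by positivity
  have hw1 : 0 < w := by linarith
  rw [delayBound_zero_sub_capacity_div hk hw1]
  have h1 : S.L / w ≤ 2 / b ^ 2 := by
    rw [div_le_div_iff₀ hw1 (by positivity)]; linarith
  have h2 : w * Real.logb 2 (w * S.q * S.L / ε) / S.α ≤ (2 / b ^ 2) ^ 2 := by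
    have h3 := logb_slice_le hε0 hε1 hk (by linarith) hα hw1 hw
    rw [hα, div_le_iff₀ (by positivity)]
    calc w * Real.logb 2 (w * S.q * S.L / ε) ≤ w * (2 * S.logSize ε) :=
          mul_le_mul_of_nonneg_left h3 hw1.le
      _ ≤ 2 * (S.L * b ^ 2) * (2 * S.logSize ε) :=
          mul_le_mul_of_nonneg_right hw (by linarith)
      _ = _ := by field_simp
  have h3 : √(w * Real.logb 2 (w * S.q * S.L / ε) / S.α) ≤ 2 / b ^ 2 :=
    Real.sqrt_le_iff.2 ⟨by positivity, h2⟩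
  have h4 : (2 / b ^ 2) ^ 2 ≤ 4 / b ^ 2 := by
    rw [div_pow, div_le_div_iff₀ (by positivity) (by positivity)]
    nlinarith
  calc _ ≤ 2 / b ^ 2 + 2 / b ^ 2 + 4 / b ^ 2 := by linarith
    _ = _ := by ring

theorem overhead_nonneg {w : ℝ} (hε0 : 0 < ε) (hε1 : ε < 1) (hk : 2 ≤ S.k) (hw : 1 ≤ w) :
    0 ≤ (S.delayBound ε w 0 - S.capacity) / S.capacity := by
  rw [delayBound_zero_sub_capacity_div hk (by linarith)]
  have := logb_slice_nonneg (S := S) hε0 hε1 hw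
  positivity

/-- The upper bound on `w` gives kL/w ≥ k/(2b²), which is already the required overhead; the other
two terms are dropped as nonnegative. -/
theorem probDelayGT_delayBound_le {b w : ℝ} (hε0 : 0 < ε) (hε1 : ε < 1) (hk : 2 ≤ S.k)
    (hb : 28 ≤ b) (hα : S.α = b ^ 6 * (S.L * S.logSize ε)) (hw1 : 1 ≤ w)
    (hw : w ≤ 2 * (S.L * b ^ 2)) :
    S.probDelayGT (S.delayBound ε w 0) ≤ ENNReal.ofReal ε := by
  refine probDelayGT_le_of_chunkSize hε0 hε1 hk hb hα ?_
  have hp := S.pMin_pos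
  have hL := S.one_le_L_cast
  have hℓ := logb_slice_nonneg (S := S) hε0 hε1 hw1
  have hb0 : 0 < b := by linarith
  have h1 : S.k / (2 * b ^ 2) ≤ S.k * S.L / w := by
    rw [div_le_div_iff₀ (by positivity) (by linarith)]
    calc S.k * w ≤ S.k * (2 * (S.L * b ^ 2)) := by gcongr
      _ = _ := by ring
  rw [delayBound, ← mul_assoc, mul_one_div_cancel hp.ne', one_mul, add_zero, one_mul]
  have h2 : S.q * (S.α + S.α / (2 * b ^ 2)) = S.k + S.k / (2 * b ^ 2) := by
    rw [k_cast]; ring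
  have h3 := Real.sqrt_nonneg (S.k * (w * S.q * Real.logb 2 (w * S.q * S.L / ε)))
  have h4 : 0 ≤ w * S.q * Real.logb 2 (w * S.q * S.L / ε) := by positivity
  rw [h2]
  linarith

end ChunkedLine

/-! ### Passage to sequences of networks -/

theorem mainTheorem3 (S : ℕ → ChunkedLine) (ε w : ℕ → ℝ)
    (hε : ∀ n, 0 < ε n ∧ ε n < 1)
    (hk : Tendsto (fun n => (S n).k) atTop atTop)
    (hq : (fun n => ((S n).q : ℝ)) =o[atTop]
      fun n => (S n).k / ((S n).L * Real.logb 2 ((S n).k * (S n).L / ε n)))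
    (hw : w ~[atTop] fun n =>
      ((S n).k * (S n).L ^ 2 / ((S n).q * Real.logb 2 ((S n).k * (S n).L / ε n))) ^ (1 / 3 : ℝ)) :
    ∃ δ : ℕ → ℝ, Tendsto δ atTop (𝓝 0) ∧
      (∀ᶠ n in atTop,
        (S n).probDelayGT ((S n).delayBound (ε n) (w n) (δ n)) ≤ ENNReal.ofReal (ε n)) ∧
      Tendsto (fun n =>
        ((S n).delayBound (ε n) (w n) (δ n) - (S n).capacity) / (S n).capacity) atTop (𝓝 0) := by
  have hk2 : ∀ᶠ n in atTop, 2 ≤ (S n).k := hk.eventually_ge_atTop 2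
  set β : ℕ → ℝ := fun n => (S n).α / ((S n).L * (S n).logSize (ε n)) with hβ
  have hβpos : ∀ᶠ n in atTop, 0 < β n := by
    filter_upwards [hk2] with n hn
    have h1 := ChunkedLine.one_le_logSize (hε n).1 (hε n).2 hn
    have h2 := ChunkedLine.α_cast_pos hn
    have h3 := (S n).one_le_L_cast
    exact div_pos (by linarith) (mul_pos (by linarith) (by linarith))
  -- 1/β is exactly the ratio that `hq` sends to zero.
  have hβtop : Tendsto β atTop atTop := by
    have h1 : Tendsto (fun n => (β n)⁻¹) atTop (𝓝 0) := by
      refine hq.tendsto_div_nhds_zero.congr fun n => ?_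
      have := (S n).q_cast_pos
      simp only [hβ, ChunkedLine.logSize, ChunkedLine.k_cast]
      field_simp
    have h2 : Tendsto (fun n => (β n)⁻¹) atTop (𝓝[>] 0) :=
      tendsto_nhdsWithin_iff.2 ⟨h1, hβpos.mono fun n hn => inv_pos.2 hn⟩
    exact h2.inv_tendsto_nhdsGT_zero.congr fun n => inv_inv _
  -- The sixth root turns the cube root in `hw` into L b² and keeps all later exponents integral.
  set b : ℕ → ℝ := fun n => β n ^ (1 / 6 : ℝ) with hb
  have hbtop : Tendsto b atTop atTop := (tendsto_rpow_atTop (by norm_num)).comp hβtop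
  have hα : ∀ᶠ n in atTop, ((S n).α : ℝ) = b n ^ 6 * ((S n).L * (S n).logSize (ε n)) := by
    filter_upwards [hk2, hβpos] with n hn hn'
    have h1 := ChunkedLine.one_le_logSize (hε n).1 (hε n).2 hn
    have h3 := (S n).one_le_L_cast
    have h4 : b n ^ 6 = β n := by
      rw [hb, ← Real.rpow_natCast, ← Real.rpow_mul hn'.le]; norm_num
    rw [h4, hβ]
    exact (div_mul_cancel₀ _ (mul_pos (by linarith) (by linarith)).ne').symm
  have hw' : (fun n => ((S n).k * (S n).L ^ 2 / ((S n).q *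
      Real.logb 2 ((S n).k * (S n).L / ε n))) ^ (1 / 3 : ℝ)) =ᶠ[atTop]
      fun n => (S n).L * b n ^ 2 := by
    filter_upwards [hβpos] with n hn
    have h1 := (S n).q_cast_pos
    have h2 : (0 : ℝ) < (S n).L := Nat.cast_pos.2 (S n).L_pos
    have h3 : (S n).k * (S n).L ^ 2 / ((S n).q * Real.logb 2 ((S n).k * (S n).L / ε n)) =
        (S n).L ^ 3 * β n := by
      simp only [hβ, ChunkedLine.logSize, ChunkedLine.k_cast]
      field_simp
    have h4 : b n ^ 2 = β n ^ (1 / 3 : ℝ) := by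
      rw [hb, ← Real.rpow_natCast, ← Real.rpow_mul hn.le]; norm_num
    rw [h3, Real.mul_rpow (by positivity) hn.le, h4, ← Real.rpow_natCast, ← Real.rpow_mul h2.le]
    norm_num
  -- Of the asymptotic equivalence, only agreement up to a factor 2 is needed.
  have hwb : ∀ᶠ n in atTop, 1 / 2 * ((S n).L * b n ^ 2) ≤ w n ∧
      w n ≤ 2 * ((S n).L * b n ^ 2) := by
    have h1 := (hw.congr_right hw').isLittleO.bound (by norm_num : (0 : ℝ) < 1 / 2)
    filter_upwards [h1] with n hn
    have h2 : (0 : ℝ) ≤ (S n).L * b n ^ 2 := by positivity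
    simp only [Pi.sub_apply, Real.norm_eq_abs, abs_of_nonneg h2] at hn
    have := abs_le.1 hn
    constructor <;> linarith
  have hw1 : ∀ᶠ n in atTop, 1 ≤ w n := by
    filter_upwards [hwb, hbtop.eventually_ge_atTop 28] with n hn hbn
    nlinarith [(S n).one_le_L_cast]
  -- The bound already holds without the correction `δ`.
  refine ⟨fun _ => 0, tendsto_const_nhds, ?_, ?_⟩
  · filter_upwards [hk2, hα, hwb, hw1, hbtop.eventually_ge_atTop 28] with n h1 h2 h3 h4 h5
    exact ChunkedLine.probDelayGT_delayBound_le (hε n).1 (hε n).2 h1 h5 h2 h4 h3.2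
  · have hlim : Tendsto (fun n => 8 / b n ^ 2) atTop (𝓝 0) :=
      tendsto_const_nhds.div_atTop ((tendsto_pow_atTop two_ne_zero).comp hbtop)
    refine tendsto_of_tendsto_of_tendsto_of_le_of_le' tendsto_const_nhds hlim ?_ ?_
    · filter_upwards [hk2, hw1] with n h1 h4
      exact ChunkedLine.overhead_nonneg (hε n).1 (hε n).2 h1 h4
    · filter_upwards [hk2, hα, hwb, hbtop.eventually_ge_atTop 28] with n h1 h2 h3 h5
      exact ChunkedLine.overhead_le (hε n).1 (hε n).2 h1 h5 h2 h3.1 h3.2
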